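/- Let $n\ge 1$ and $N=\{1,\dots,n\}$ (the regions). Let $\sigma>1$, let $\Phi=[\phi_{ij}]$ be a real $n\times n$ matrix with $\phi_{ii}=1$ and $\phi_{ij}\in(0,1)$ for $i\neq j$ (the geographical proximity matrix), and let $\Psi=[\psi_{ij}]$ be a real $n\times n$ matrix with $\psi_{ii}=1$, $\psi_{ij}\in(0,1]$, and $\sum_{i,j}\psi_{ij}z_iz_j>0$ for every $z\in\mathbb{R}^n\setminus\{0\}$ with $\sum_i z_i=0$ (the externality matrix). For a distribution of workers $x\in X=\{x\in\mathbb{R}^n : x_i\ge 0,\ \sum_i x_i=1\}$ put $a_i(x)=\sum_j\psi_{ij}x_j$. A market wage at $x$ is a vector $w\in[0,\infty]^n$ with $$w_ix_i=\sum_{k\in N}\frac{a_i^{\sigma-1}w_i^{1-\sigma}\phi_{ik}}{\sum_{l\in N}a_l^{\sigma-1}w_l^{1-\sigma}\phi_{lk}}\,w_kx_k\quad(i\in N),\qquad \sum_{i\in N}w_ix_i=1,$$ with the conventions $\infty\cdot 0=0$, $\infty^{1-\sigma}=0$, $0^{1-\sigma}=\infty$ and $c/\infty=0$ for all $c\in[0,\infty]$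 (so that $0<w_i<\infty$ in populated regions and $w_i=\infty$ in regions with $x_i=0$). The price index and the utility in region $i$ are $$P_i=\Bigl(\sum_{j\in N}a_j^{\sigma-1}w_j^{1-\sigma}\phi_{ji}\Bigr)^{\frac1{1-\sigma}},\qquad v_i=\frac{w_i}{P_i}.$$ A spatial equilibrium is a distribution $x\in X$ together with a market wage $w$ at $x$ for which there is a $v^*$ with $v_i=v^*$ for all $i$ with $x_i>0$ and $v_i\le v^*$ for all $i$ with $x_i=0$. Then a spatial equilibrium exists, and there is one in which the utilities $v_i$ are equal across all regions. Moreover, every spatial equilibrium $(x,w)$ satisfies $x_i>0$ for all $i\in N$. -/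

import Mathlib

open scoped ENNReal Matrix

noncomputable section

namespace ArmingtonEconomy

/-- Admissible externality matrices `ψ`: entries in `(0,1]`, unit diagonal, and the quadratic form
is positive on the nonzero vectors whose coordinates sum to zero. -/
structure IsExternalityMatrix {n : ℕ} (ψ : Matrix (Fin n) (Fin n) ℝ) : Prop where
  pos : ∀ i j, 0 < ψ i j
  le_one : ∀ i j, ψ i j ≤ 1
  diag : ∀ i, ψ i i = 1
  cond_pos_def : ∀ z : Fin n → ℝ, z ≠ 0 → ∑ i, z i = 0 → 0 < ∑ i, ∑ j, ψ i j * z i * z j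

/-- Admissible geographical proximity matrices `φ i j = τ i j ^ (1 - σ)`, where `1 < τ i j < ∞` for
`i ≠ j` and `τ i i = 1` are the iceberg transportation costs. -/
structure IsProximityMatrix {n : ℕ} (φ : Matrix (Fin n) (Fin n) ℝ) : Prop where
  off_diag_pos : ∀ i j, i ≠ j → 0 < φ i j
  off_diag_lt_one : ∀ i j, i ≠ j → φ i j < 1
  diag : ∀ i, φ i i = 1

/-- The productivity `a_i(x) = ∑ j, ψ i j * x j` of region `i`. -/
def productivity {n : ℕ} (ψ : Matrix (Fin n) (Fin n) ℝ) (x : Fin n → ℝ) (i : Fin n) : ℝ :=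
  ∑ j, ψ i j * x j

/-- The competitiveness `a_i ^ (σ - 1) * w_i ^ (1 - σ) * φ i j` (that is, `p_{ij} ^ (1 - σ)` for the
price `p_{ij} = w_i * τ i j / a_i`) of the good of region `i` in region `j`.
Wages take values in `[0, ∞]`, so that the wage of a region without workers may be infinite;
`∞ ^ (1 - σ) = 0` for `σ > 1`. -/
def competitiveness {n : ℕ} (σ : ℝ) (φ ψ : Matrix (Fin n) (Fin n) ℝ) (x : Fin n → ℝ)
    (w : Fin n → ℝ≥0∞) (i j : Fin n) : ℝ≥0∞ :=
  ENNReal.ofReal (productivity ψ x i) ^ (σ - 1) * w i ^ (1 - σ) * ENNReal.ofReal (φ i j)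

/-- The CES price index `P_j` of region `j`. -/
def priceIndex {n : ℕ} (σ : ℝ) (φ ψ : Matrix (Fin n) (Fin n) ℝ) (x : Fin n → ℝ)
    (w : Fin n → ℝ≥0∞) (j : Fin n) : ℝ≥0∞ :=
  (∑ i, competitiveness σ φ ψ x w i j) ^ (1 / (1 - σ))

/-- The total wage income `w_i * x_i` of region `i`, with `∞ * 0 = 0`. -/
def income {n : ℕ} (x : Fin n → ℝ) (w : Fin n → ℝ≥0∞) (i : Fin n) : ℝ≥0∞ :=
  w i * ENNReal.ofReal (x i)

/-- The value `Q_{ik}` of the goods shipped from region `i` to region `k`. -/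
def tradeValue {n : ℕ} (σ : ℝ) (φ ψ : Matrix (Fin n) (Fin n) ℝ) (x : Fin n → ℝ)
    (w : Fin n → ℝ≥0∞) (i k : Fin n) : ℝ≥0∞ :=
  competitiveness σ φ ψ x w i k / (∑ l, competitiveness σ φ ψ x w l k) * income x w k

/-- `w` is a market wage at the spatial distribution `x`: in every region income equals the value
of the goods sold in all regions, and total income is normalized to one. Under the
standing assumptions these equations force `0 < w i < ∞` where `x i > 0`, and `w i = ∞` where
`x i = 0`. -/
structure IsMarketWage {n : ℕ} (σ : ℝ) (φ ψ : Matrix (Fin n) (Fin n) ℝ) (x : Fin n → ℝ)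
    (w : Fin n → ℝ≥0∞) : Prop where
  clearing : ∀ i, income x w i = ∑ k, tradeValue σ φ ψ x w i k
  normalized : ∑ i, income x w i = 1

/-- The per capita indirect utility `v_i = w_i / P_i` in region `i`. -/
def utility {n : ℕ} (σ : ℝ) (φ ψ : Matrix (Fin n) (Fin n) ℝ) (x : Fin n → ℝ)
    (w : Fin n → ℝ≥0∞) (i : Fin n) : ℝ≥0∞ :=
  w i / priceIndex σ φ ψ x w i

/-- A spatial equilibrium: a distribution `x` of the unit mass of workers with a market wage `w`,
such that no worker has an incentive to move. -/
structure IsSpatialEquilibrium {n : ℕ} (σ : ℝ) (φ ψ : Matrix (Fin n) (Fin n) ℝ) (x : Fin n → ℝ)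
    (w : Fin n → ℝ≥0∞) : Prop where
  mem_simplex : x ∈ stdSimplex ℝ (Fin n)
  market : IsMarketWage σ φ ψ x w
  nash : ∃ v : ℝ≥0∞, (∀ i, 0 < x i → utility σ φ ψ x w i = v) ∧
    (∀ i, x i = 0 → utility σ φ ψ x w i ≤ v)

end ArmingtonEconomy

end

open scoped ENNReal Matrix

/-! Existence. If all regions are populated and all utilities equal `v`, then `P_k = w_k / v`. Put
`u_k = w_k ^ (1 - σ)`, `y_k = w_k ^ σ * x_k` and `K_ik = a_i ^ (σ - 1) * φ i k`. The definition of
the price index becomes `∑ i, K_ik u_i = l u_k` with `l = v ^ (σ - 1)`, and market clearing becomes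
`∑ k, K_ik y_k = l y_i`. So a left and a right Perron vector with the same eigenvalue are needed,
but `K` depends on `x = y * u ^ (σ / (σ - 1))` (normalized) through the productivities. The entries
of `K` are bounded above and away from zero, so Brouwer's theorem applies to the simultaneous
normalized iteration of `y` and `u` (`exists_pos_left_right_eigenvector`); pairing the two
eigenvectors shows that their eigenvalues agree.

Brouwer's theorem is proved by change of variables: integrals pulled back along `x ↦ x + t G x` are
polynomial in `t` and constant for small `t`, hence unchanged at `t = 1`, which forces `x + G x` to
come arbitrarily close to zero.

Positivity. An empty region with a finite wage would sell goods but earn nothing, so its wage is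
infinite; its price index is finite, so its utility is infinite, whereas populated regions have
finite utility. -/

/-! ### Brouwer's fixed point theorem by change of variables -/

open MeasureTheory Metric Polynomial in
/-- If `F t x` is polynomial in `t` of degree at most `d` and its integral over `s` does not depend
on `t` for small `t`, then the integral has the same value at `t = 1`. -/
theorem setIntegral_eq_of_polynomial {E : Type*} [MeasurableSpace E] {μ : Measure E} {s : Set E}
    {F : ℝ → E → ℝ} {d : ℕ} {c ε : ℝ} (hε : 0 < ε)
    (hF : ∀ x, ∃ P : ℝ[X], P.natDegree ≤ d ∧ ∀ t, F t x = P.eval t)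
    (hint : ∀ t, IntegrableOn (F t) s μ)
    (hc : ∀ t, |t| < ε → ∫ x in s, F t x ∂μ = c) :
    ∫ x in s, F 1 x ∂μ = c := by
  let S := Finset.range (d + 1)
  -- Interpolation nodes; the shift by `2` keeps even the node `k = 0` strictly below `ε`.
  let v : ℕ → ℝ := fun k => ε / (k + 2)
  have hv : Set.InjOn v S := by
    intro a _ b _ hab
    have ha : (0 : ℝ) < a + 2 := by positivity
    have hb : (0 : ℝ) < b + 2 := by positivity
    simp only [v] at hab
    rw [div_eq_div_iff ha.ne' hb.ne'] at hab
    have := mul_left_cancel₀ hε.ne' hab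
    exact_mod_cast (by linarith : (a : ℝ) = b)
  have hlt : ∀ k, |v k| < ε := by
    intro k
    have hk : (0 : ℝ) < k + 2 := by positivity
    rw [abs_of_pos (by positivity), div_lt_iff₀ hk]
    nlinarith [(Nat.cast_nonneg k : (0 : ℝ) ≤ k)]
  have hS : S.Nonempty := ⟨0, by simp [S]⟩
  -- Extrapolation from `d + 1` nodes is exact in degree `d`, with weights independent of `x` and of
  -- total `1`.
  have key : ∀ x, F 1 x = ∑ k ∈ S, (Lagrange.basis S v k).eval 1 * F (v k) x := by
    intro x
    obtain ⟨P, hP, hPF⟩ := hF x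
    have hdeg : P.degree < S.card := by
      refine lt_of_le_of_lt degree_le_natDegree ?_
      simp only [S, Finset.card_range]
      exact_mod_cast Nat.lt_succ_of_le hP
    have h := congrArg (eval 1) (Lagrange.eq_interpolate hv hdeg)
    rw [Lagrange.interpolate_apply, eval_finsetSum] at h
    rw [hPF, h]
    refine Finset.sum_congr rfl fun k _ => ?_
    rw [eval_mul, eval_C, hPF, mul_comm]
  have hsum : ∑ k ∈ S, (Lagrange.basis S v k).eval 1 = 1 := by
    rw [← eval_finsetSum, Lagrange.sum_basis hv hS, eval_one]
  simp_rw [key]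
  rw [integral_finsetSum _ fun k _ => (hint (v k)).const_mul _]
  simp_rw [integral_const_mul, hc _ (hlt _)]
  rw [← Finset.sum_mul, hsum, one_mul]

open Polynomial in
theorem exists_polynomial_det_id_add_smul {E : Type*} [NormedAddCommGroup E] [NormedSpace ℝ E]
    [FiniteDimensional ℝ E] (A : E →L[ℝ] E) :
    ∃ P : ℝ[X], P.natDegree ≤ Module.finrank ℝ E ∧
      ∀ t : ℝ, (ContinuousLinearMap.id ℝ E + t • A).det = P.eval t := by
  let b := Module.finBasis ℝ E
  let M := LinearMap.toMatrix b b (A : E →ₗ[ℝ] E)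
  refine ⟨_, (natDegree_det_X_add_C_le M 1).trans (by simp), fun t => ?_⟩
  rw [← Polynomial.coe_evalRingHom, RingHom.map_det, ContinuousLinearMap.det,
    ← LinearMap.det_toMatrix b]
  congr 1
  ext i j
  by_cases h : i = j <;>
    simp [M, LinearMap.toMatrix_apply, h, add_comm, mul_comm t]

open MeasureTheory Metric in
/-- Small perturbations of the identity by a compactly supported map permute the ball. -/
theorem setIntegral_det_id_add_smul_eq {E : Type*} [NormedAddCommGroup E] [NormedSpace ℝ E]
    [FiniteDimensional ℝ E] [MeasurableSpace E] [BorelSpace E] (μ : Measure E) [μ.IsAddHaarMeasure]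
    {G : E → E} (hG : ContDiff ℝ 1 G) (hGc : HasCompactSupport G) {r : ℝ}
    (hr : ∀ x, r < ‖x‖ → G x = 0) :
    ∃ ε > 0, ∀ t : ℝ, |t| < ε → ∀ φ : E → ℝ,
      ∫ x in closedBall (0 : E) r,
        (ContinuousLinearMap.id ℝ E + t • fderiv ℝ G x).det * φ (x + t • G x) ∂μ =
      ∫ x in closedBall (0 : E) r, φ x ∂μ := by
  obtain ⟨C, hC⟩ := ContDiff.lipschitzWith_of_hasCompactSupport hGc hG (by simp)
  obtain ⟨δ, hδ, hdet⟩ : ∃ δ > 0, ∀ A : E →L[ℝ] E,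
      ‖A‖ < δ → 0 < (ContinuousLinearMap.id ℝ E + A).det := by
    have h1 : Continuous fun A : E →L[ℝ] E => (ContinuousLinearMap.id ℝ E + A).det :=
      ContinuousLinearMap.continuous_det.comp (by fun_prop)
    have h2 : ∀ᶠ A in nhds (0 : E →L[ℝ] E), 0 < (ContinuousLinearMap.id ℝ E + A).det := by
      refine h1.continuousAt.eventually (lt_mem_nhds ?_)
      simp [ContinuousLinearMap.det]
    obtain ⟨δ, hδ, h⟩ := Metric.eventually_nhds_iff.1 h2
    exact ⟨δ, hδ, fun A hA => h (by simpa using hA)⟩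
  have hC1 : (0 : ℝ) < C + 1 := by positivity
  -- Below `δ` the Jacobian determinant stays positive; below `1` the perturbation `t • G` is a
  -- contraction, so `h` is bijective.
  refine ⟨min δ 1 / (C + 1), by positivity, fun t ht φ => ?_⟩
  rw [lt_div_iff₀ hC1] at ht
  have htC : |t| * C < min δ 1 := by nlinarith [abs_nonneg t]
  let h : E → E := fun x => x + t • G x
  have happ : ApproximatesLinearOn h ((ContinuousLinearEquiv.refl ℝ E : E ≃L[ℝ] E) : E →L[ℝ] E)
      Set.univ (‖t‖₊ * C) := by
    rw [ApproximatesLinearOn.approximatesLinearOn_iff_lipschitzOnWith, lipschitzOnWith_univ]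
    have : h - ⇑((ContinuousLinearEquiv.refl ℝ E : E ≃L[ℝ] E) : E →L[ℝ] E) = fun x => t • G x := by
      ext x; simp [h]
    rw [this]
    exact (lipschitzWith_smul t).comp hC
  have hsmall : Subsingleton E ∨
      ‖t‖₊ * C < ‖((ContinuousLinearEquiv.refl ℝ E).symm : E →L[ℝ] E)‖₊⁻¹ := by
    rcases subsingleton_or_nontrivial E with hE | hE
    · exact Or.inl hE
    · right
      have h1 : ‖((ContinuousLinearEquiv.refl ℝ E).symm : E →L[ℝ] E)‖₊ = 1 := by
        have : ((ContinuousLinearEquiv.refl ℝ E).symm : E →L[ℝ] E) = ContinuousLinearMap.id ℝ E := by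
          ext x; simp
        rw [this]
        ext
        simp
      rw [h1, inv_one, ← NNReal.coe_lt_coe]
      push_cast
      exact htC.trans_le (min_le_right _ _)
  have hinj : Function.Injective h := Set.injOn_univ.1 (happ.injOn hsmall)
  have hsurj : Function.Surjective h := happ.surjective hsmall
  have hout : ∀ x, r < ‖x‖ → h x = x := fun x hx => by simp [h, hr x hx]
  -- A bijection that is the identity outside the ball must permute the ball.
  have himg : h '' closedBall 0 r = closedBall 0 r := by
    ext y
    simp only [Set.mem_image, mem_closedBall_zero_iff]
    constructor
    · rintro ⟨x, hx, rfl⟩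
      by_contra! hc
      have := hinj (hout _ hc)
      rw [this] at hc
      linarith
    · intro hy
      obtain ⟨x, rfl⟩ := hsurj y
      refine ⟨x, ?_, rfl⟩
      by_contra! hc
      rw [hout x hc] at hy
      linarith
  have hder : ∀ x, HasFDerivAt h (ContinuousLinearMap.id ℝ E + t • fderiv ℝ G x) x := fun x =>
    (hasFDerivAt_id x).add (((hG.differentiable (by simp)) x).hasFDerivAt.const_smul t)
  have hcv := integral_image_eq_integral_abs_det_fderiv_smul μ
    (measurableSet_closedBall (x := (0 : E)) (ε := r))
    (fun x _ => (hder x).hasFDerivWithinAt) hinj.injOn φ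
  rw [himg] at hcv
  rw [hcv]
  refine integral_congr_ae (Filter.Eventually.of_forall fun x => ?_)
  have hpos := hdet (t • fderiv ℝ G x) (by
    rw [norm_smul, Real.norm_eq_abs]
    calc |t| * ‖fderiv ℝ G x‖ ≤ |t| * C := by
          gcongr
          exact norm_fderiv_le_of_lipschitz ℝ hC
      _ < δ := htC.trans_le (min_le_left _ _))
  simp only [abs_of_pos hpos, smul_eq_mul, h]

-- The integrand of the change of variables along `x ↦ x + t • G x` has degree at most `finrank + 2
-- * k` in `t`, so its invariance for small `t` extends to `t = 1`, where the map need not be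
-- injective.
open MeasureTheory Metric Polynomial in
theorem setIntegral_det_id_add_mul_pow_eq {E : Type*} [NormedAddCommGroup E] [InnerProductSpace ℝ E]
    [FiniteDimensional ℝ E] [MeasurableSpace E] [BorelSpace E] (μ : Measure E) [μ.IsAddHaarMeasure]
    {G : E → E} (hG : ContDiff ℝ 1 G) (hGc : HasCompactSupport G) {r : ℝ}
    (hr : ∀ x, r < ‖x‖ → G x = 0) (a : ℝ) (k : ℕ) :
    ∫ x in closedBall (0 : E) r,
        (ContinuousLinearMap.id ℝ E + fderiv ℝ G x).det * (1 - a * ‖x + G x‖ ^ 2) ^ k ∂μ =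
      ∫ x in closedBall (0 : E) r, (1 - a * ‖x‖ ^ 2) ^ k ∂μ := by
  obtain ⟨ε, hε, h⟩ := setIntegral_det_id_add_smul_eq μ hG hGc hr
  have key := setIntegral_eq_of_polynomial (μ := μ) (s := closedBall (0 : E) r)
    (F := fun t x => (ContinuousLinearMap.id ℝ E + t • fderiv ℝ G x).det *
      (1 - a * ‖x + t • G x‖ ^ 2) ^ k) (d := Module.finrank ℝ E + k * 2) hε ?_ ?_
    (fun t ht => h t ht fun y => (1 - a * ‖y‖ ^ 2) ^ k)
  · simpa using key
  · intro x
    obtain ⟨P, hP, hPe⟩ := exists_polynomial_det_id_add_smul (fderiv ℝ G x)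
    refine ⟨P * (C (-a * ‖G x‖ ^ 2) * X ^ 2 + C (-a * (2 * inner ℝ x (G x))) * X +
      C (1 - a * ‖x‖ ^ 2)) ^ k, ?_, fun t => ?_⟩
    · refine natDegree_mul_le.trans (add_le_add hP (natDegree_pow_le.trans ?_))
      exact Nat.mul_le_mul_left k natDegree_quadratic_le
    · have : ‖x + t • G x‖ ^ 2 = ‖x‖ ^ 2 + 2 * (t * inner ℝ x (G x)) + t ^ 2 * ‖G x‖ ^ 2 := by
        rw [norm_add_sq_real, inner_smul_right, norm_smul, mul_pow, Real.norm_eq_abs, sq_abs]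
      simp only [hPe, this, eval_mul, eval_pow, eval_add, eval_C, eval_X]
      ring
  · intro t
    refine ContinuousOn.integrableOn_compact (isCompact_closedBall (0 : E) r) (Continuous.continuousOn ?_)
    have h1 : Continuous (fderiv ℝ G) := hG.continuous_fderiv (by simp)
    have h2 : Continuous G := hG.continuous
    refine (ContinuousLinearMap.continuous_det.comp ?_).mul ?_ <;> fun_prop

open MeasureTheory Metric Filter in
/-- `x ↦ x + G x` has values arbitrarily close to zero if `G` is `C¹` with compact support. -/
theorem exists_norm_add_lt_of_hasCompactSupport {E : Type*} [NormedAddCommGroup E]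
    [InnerProductSpace ℝ E] [FiniteDimensional ℝ E]
    {G : E → E} (hG : ContDiff ℝ 1 G) (hGc : HasCompactSupport G) {δ : ℝ} (hδ : 0 < δ) :
    ∃ x, ‖x + G x‖ < δ := by
  by_contra! hfar
  let _ : MeasurableSpace E := borel E
  have : BorelSpace E := ⟨rfl⟩
  let μ : Measure E := Measure.addHaar
  obtain ⟨r, hδr, hr⟩ : ∃ r, δ ≤ r ∧ ∀ x, r < ‖x‖ → G x = 0 := by
    obtain ⟨r, hr⟩ := hGc.isCompact.isBounded.subset_closedBall 0
    refine ⟨max r δ, le_max_right _ _, fun x hx => ?_⟩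
    by_contra hne
    have := hr (subset_tsupport G hne)
    rw [mem_closedBall_zero_iff] at this
    exact absurd hx (not_lt.2 (this.trans (le_max_left _ _)))
  have hB : IsCompact (closedBall (0 : E) r) := isCompact_closedBall 0 r
  have hGcont : Continuous G := hG.continuous
  have hdcont : Continuous fun x => (ContinuousLinearMap.id ℝ E + fderiv ℝ G x).det :=
    ContinuousLinearMap.continuous_det.comp
      (continuous_const.add (hG.continuous_fderiv (by simp)))
  obtain ⟨ρ₀, hρ₀⟩ := hB.exists_bound_of_continuousOn (f := fun x => x + G x) (by fun_prop)
  obtain ⟨M, hM⟩ := hB.exists_bound_of_continuousOn hdcont.continuousOn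
  let ρ := max ρ₀ r
  have hρpos : 0 < ρ := hδ.trans_le (hδr.trans (le_max_right _ _))
  -- On the ball of radius `r`, both `‖x‖` and `‖x + G x‖` are at most `ρ`, so this scaling makes
  -- the weights `1 - a * ‖·‖ ^ 2` nonnegative.
  let a := (ρ ^ 2)⁻¹
  have ha : 0 < a := by positivity
  have haρ : a * ρ ^ 2 = 1 := inv_mul_cancel₀ (by positivity)
  have hnonneg : ∀ s : ℝ, 0 ≤ s → s ≤ ρ → 0 ≤ 1 - a * s ^ 2 := fun s h0 hs => by
    have : a * s ^ 2 ≤ a * ρ ^ 2 := by gcongr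
    linarith
  -- `q` bounds the weight at `x + G x` from above, `q'` the weight on the ball of radius `δ / 2`
  -- from below; `k`-th powers with `q < q'` contradict the equality of the integrals.
  let q := 1 - a * δ ^ 2
  let q' := 1 - a * (δ / 2) ^ 2
  have hq : 0 ≤ q := hnonneg δ hδ.le (hδr.trans (le_max_right _ _))
  have hqq' : q < q' := by
    have : 0 < a * δ ^ 2 := by positivity
    simp only [q, q']
    nlinarith
  have hq' : 0 < q' := hq.trans_lt hqq'
  have hcontk : ∀ k : ℕ, Continuous fun x : E => (1 - a * ‖x‖ ^ 2) ^ k := fun k => by fun_prop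
  have hM0 : 0 ≤ M := (norm_nonneg _).trans (hM 0 (by simpa using hδ.le.trans hδr))
  let V := μ.real (closedBall (0 : E) r)
  let V' := μ.real (closedBall (0 : E) (δ / 2))
  have hV' : 0 < V' := by
    refine ENNReal.toReal_pos (measure_closedBall_pos μ 0 (by positivity)).ne' ?_
    exact measure_closedBall_lt_top.ne
  have hineq : ∀ k : ℕ, V' * q' ^ k ≤ M * V * q ^ k := by
    intro k
    have hup : ∫ x in closedBall (0 : E) r,
        (ContinuousLinearMap.id ℝ E + fderiv ℝ G x).det * (1 - a * ‖x + G x‖ ^ 2) ^ k ∂μ ≤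
        M * q ^ k * V := by
      refine (Real.le_norm_self _).trans ?_
      refine norm_setIntegral_le_of_norm_le_const (measure_closedBall_lt_top (μ := μ)) fun x hx => ?_
      have h0 : 0 ≤ 1 - a * ‖x + G x‖ ^ 2 :=
        hnonneg _ (norm_nonneg _) ((hρ₀ x hx).trans (le_max_left _ _))
      rw [norm_mul, norm_pow, Real.norm_of_nonneg h0]
      refine mul_le_mul (hM x hx) ?_ (by positivity) hM0
      refine pow_le_pow_left₀ h0 ?_ k
      have : a * δ ^ 2 ≤ a * ‖x + G x‖ ^ 2 := by
        have := hfar x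
        gcongr
      simp only [q]
      linarith
    have hlow : V' * q' ^ k ≤ ∫ x in closedBall (0 : E) r, (1 - a * ‖x‖ ^ 2) ^ k ∂μ := by
      calc V' * q' ^ k = ∫ _ in closedBall (0 : E) (δ / 2), q' ^ k ∂μ := by
            rw [setIntegral_const, smul_eq_mul]
        _ ≤ ∫ x in closedBall (0 : E) (δ / 2), (1 - a * ‖x‖ ^ 2) ^ k ∂μ := by
            refine setIntegral_mono_on (integrableOn_const (measure_closedBall_lt_top (μ := μ)).ne)
              ((hcontk k).continuousOn.integrableOn_compact (isCompact_closedBall _ _))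
              measurableSet_closedBall fun x hx => ?_
            refine pow_le_pow_left₀ hq'.le ?_ k
            have : a * ‖x‖ ^ 2 ≤ a * (δ / 2) ^ 2 := by
              have := mem_closedBall_zero_iff.1 hx
              gcongr
            simp only [q']
            linarith
        _ ≤ _ := by
            refine setIntegral_mono_set ((hcontk k).continuousOn.integrableOn_compact hB) ?_
              (LE.le.eventuallyLE (closedBall_subset_closedBall (by linarith)))
            refine (ae_restrict_iff' measurableSet_closedBall).2 (Eventually.of_forall ?_)
            intro x hx
            exact pow_nonneg (hnonneg _ (norm_nonneg _)
              ((mem_closedBall_zero_iff.1 hx).trans (le_max_right _ _))) k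
    rw [setIntegral_det_id_add_mul_pow_eq μ hG hGc hr a k] at hup
    linarith
  have hlim : Tendsto (fun k : ℕ => M * V * (q / q') ^ k) atTop (nhds (M * V * 0)) :=
    (tendsto_pow_atTop_nhds_zero_of_lt_one (by positivity) ((div_lt_one hq').2 hqq')).const_mul _
  have hle : V' ≤ M * V * 0 := ge_of_tendsto' hlim fun k => by
    rw [div_pow, mul_div_assoc', le_div_iff₀ (by positivity)]
    exact hineq k
  linarith

open Metric in
/-- **Brouwer's fixed point theorem**, for bounded continuous self-maps of a Euclidean space. -/
theorem Continuous.exists_fixedPoint_of_bounded {E : Type*} [NormedAddCommGroup E]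
    [InnerProductSpace ℝ E] [FiniteDimensional ℝ E] {f : E → E} (hf : Continuous f) {R : ℝ}
    (hR : ∀ x, ‖f x‖ ≤ R) : ∃ x, f x = x := by
  by_contra! hne
  have hR0 : 0 ≤ R := (norm_nonneg _).trans (hR 0)
  -- The cutoff gives compact support without new fixed points: those of `χ • f` have norm at most
  -- `R`, where `χ = 1`.
  let χ : E → ℝ := fun x => max 0 (min 1 (R + 1 - ‖x‖))
  have hχ : Continuous χ := by fun_prop
  have hχ1 : ∀ x, χ x ≤ 1 := fun x => max_le zero_le_one (min_le_left _ _)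
  have hχ0 : ∀ x, 0 ≤ χ x := fun x => le_max_left _ _
  let F : E → E := fun x => χ x • f x
  have hF : Continuous F := hχ.smul hf
  have hFne : ∀ x, F x ≠ x := by
    intro x hx
    have hxR : ‖x‖ ≤ R := by
      calc ‖x‖ = χ x * ‖f x‖ := by
            conv_lhs => rw [← hx]
            rw [norm_smul, Real.norm_of_nonneg (hχ0 x)]
        _ ≤ 1 * R := mul_le_mul (hχ1 x) (hR x) (norm_nonneg _) zero_le_one
        _ = R := one_mul R
    have : χ x = 1 := by
      simp only [χ]
      rw [min_eq_left (by linarith), max_eq_right zero_le_one]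
    simp only [F, this, one_smul] at hx
    exact hne x hx
  have hF0 : ∀ x, R + 1 ≤ ‖x‖ → F x = 0 := by
    intro x hx
    have : χ x = 0 := by
      simp only [χ]
      exact max_eq_left ((min_le_right _ _).trans (by linarith))
    simp [F, this]
  have hFc : HasCompactSupport F := by
    refine HasCompactSupport.intro (isCompact_closedBall (0 : E) (R + 1)) fun x hx => hF0 x ?_
    rw [mem_closedBall_zero_iff, not_le] at hx
    exact hx.le
  obtain ⟨δ, hδ, hfar⟩ : ∃ δ > 0, ∀ x, δ ≤ ‖x - F x‖ := by
    obtain ⟨x₀, -, hmin⟩ := (isCompact_closedBall (0 : E) (R + 1)).exists_isMinOn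
      ⟨0, by simp; linarith⟩ (f := fun x => ‖x - F x‖) (by fun_prop)
    refine ⟨min ‖x₀ - F x₀‖ 1, lt_min (norm_pos_iff.2 (sub_ne_zero.2 (hFne x₀).symm)) one_pos,
      fun x => ?_⟩
    rcases le_total ‖x‖ (R + 1) with h | h
    · exact (min_le_left _ _).trans (hmin (mem_closedBall_zero_iff.2 h))
    · rw [hF0 x h, sub_zero]
      exact (min_le_right _ _).trans (by linarith)
  obtain ⟨g, hg, hgF, hgs⟩ := hF.exists_contDiff_approx 1 (continuous_const (y := δ / 2))
    fun _ => by positivity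
  obtain ⟨x, hx⟩ := exists_norm_add_lt_of_hasCompactSupport (G := -g) (δ := δ / 2) hg.neg
    (hFc.mono (by simpa using hgs)) (by positivity)
  have h1 := hgF x
  rw [dist_eq_norm] at h1
  have h2 : ‖x - F x‖ ≤ ‖x + (-g) x‖ + ‖g x - F x‖ := by
    refine le_trans (le_of_eq ?_) (norm_add_le _ _)
    congr 1
    simp only [Pi.neg_apply]
    abel
  linarith [hfar x]

/-! ### Nonlinear Perron theorem -/

/-- A nonlinear Perron theorem: a positive matrix that depends continuously on its prospective
right and left eigenvectors has a positive right and a positive left eigenvector,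
with the same eigenvalue. -/
theorem exists_pos_left_right_eigenvector {ι : Type*} [Fintype ι] [Nonempty ι]
    (K : (ι → ℝ) → (ι → ℝ) → ι → ι → ℝ) {m : ℝ} (hm : 0 < m)
    (hK : ∀ y u, (∀ i, 0 < y i) → (∀ i, 0 < u i) → ∀ i k, m ≤ K y u i k ∧ K y u i k ≤ 1)
    (hcont : ∀ i k, ContinuousOn (fun p : (ι → ℝ) × (ι → ℝ) => K p.1 p.2 i k)
      {p | (∀ i, 0 < p.1 i) ∧ ∀ i, 0 < p.2 i}) :
    ∃ (y u : ι → ℝ) (l : ℝ), (∀ i, 0 < y i) ∧ (∀ i, 0 < u i) ∧ 0 < l ∧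
      (∀ i, ∑ k, K y u i k * y k = l * y i) ∧ (∀ k, ∑ i, K y u i k * u i = l * u k) := by
  have hN : (0 : ℝ) < Fintype.card ι := by exact_mod_cast Fintype.card_pos
  let ε : ℝ := m / Fintype.card ι
  have hε : 0 < ε := by positivity
  -- any positive matrix with entries in `[m, 1]` maps positive vectors to vectors whose
  -- normalization has entries at least `ε`
  have hbound : ∀ (A : ι → ι → ℝ) (z : ι → ℝ), (∀ i k, m ≤ A i k ∧ A i k ≤ 1) → (∀ i, 0 < z i) →
      0 < ∑ j, ∑ k, A j k * z k ∧
      ∀ i, ε ≤ (∑ k, A i k * z k) / ∑ j, ∑ k, A j k * z k := by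
    intro A z hA hz
    have hzs : 0 < ∑ k, z k := Finset.sum_pos (fun i _ => hz i) Finset.univ_nonempty
    have hlow : ∀ i, m * ∑ k, z k ≤ ∑ k, A i k * z k := fun i => by
      rw [Finset.mul_sum]
      exact Finset.sum_le_sum fun k _ => mul_le_mul_of_nonneg_right (hA i k).1 (hz k).le
    have hup : ∀ i, ∑ k, A i k * z k ≤ ∑ k, z k := fun i =>
      Finset.sum_le_sum fun k _ => mul_le_of_le_one_left (hz k).le (hA i k).2
    have hpos : 0 < ∑ j, ∑ k, A j k * z k :=
      Finset.sum_pos (fun i _ => (mul_pos hm hzs).trans_le (hlow i)) Finset.univ_nonempty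
    refine ⟨hpos, fun i => ?_⟩
    rw [le_div_iff₀ hpos]
    have hle : ∑ j, ∑ k, A j k * z k ≤ Fintype.card ι * ∑ k, z k := by
      calc _ ≤ ∑ _j : ι, ∑ k, z k := Finset.sum_le_sum fun j _ => hup j
        _ = _ := by simp
    calc ε * ∑ j, ∑ k, A j k * z k ≤ ε * (Fintype.card ι * ∑ k, z k) := by gcongr
      _ = m * ∑ k, z k := by simp only [ε]; field_simp
      _ ≤ _ := hlow i
  -- Truncation at `ε` makes the map defined and continuous everywhere; it is inactive at a fixed
  -- point, whose entries are at least `ε` by `hbound`.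
  let Y : EuclideanSpace ℝ (ι ⊕ ι) → ι → ℝ := fun z i => max ε (z (Sum.inl i))
  let U : EuclideanSpace ℝ (ι ⊕ ι) → ι → ℝ := fun z i => max ε (z (Sum.inr i))
  have hY : ∀ z i, 0 < Y z i := fun z i => hε.trans_le (le_max_left _ _)
  have hU : ∀ z i, 0 < U z i := fun z i => hε.trans_le (le_max_left _ _)
  let A : EuclideanSpace ℝ (ι ⊕ ι) → ι → ι → ℝ := fun z => K (Y z) (U z)
  have hA : ∀ z i k, m ≤ A z i k ∧ A z i k ≤ 1 := fun z => hK _ _ (hY z) (hU z)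
  have hT := fun z => hbound (A z) (Y z) (hA z) (hY z)
  have hS := fun z => hbound (fun k i => A z i k) (U z) (fun i k => hA z k i) (hU z)
  have hYc : ∀ i, Continuous fun z => Y z i := fun i => by fun_prop
  have hUc : ∀ i, Continuous fun z => U z i := fun i => by fun_prop
  have hAc : ∀ i k, Continuous fun z => A z i k := fun i k =>
    (hcont i k).comp_continuous (f := fun z => (Y z, U z))
      ((continuous_pi hYc).prodMk (continuous_pi hUc)) fun z => ⟨hY z, hU z⟩
  let f : EuclideanSpace ℝ (ι ⊕ ι) → EuclideanSpace ℝ (ι ⊕ ι) := fun z =>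
    WithLp.toLp 2 (Sum.elim
    (fun i => (∑ k, A z i k * Y z k) / ∑ j, ∑ k, A z j k * Y z k)
    (fun k => (∑ i, A z i k * U z i) / ∑ j, ∑ i, A z i j * U z i))
  have hf : Continuous f := by
    refine (PiLp.continuous_toLp 2 _).comp (continuous_pi ?_)
    rintro (i | i)
    · refine Continuous.div ?_ ?_ fun z => (hT z).1.ne' <;> fun_prop
    · refine Continuous.div ?_ ?_ fun z => (hS z).1.ne' <;> fun_prop
  have hle1 : ∀ (v : ι → ℝ) (i : ι), (∀ i, 0 ≤ v i) → v i / ∑ j, v j ≤ 1 := fun v i hv =>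
    div_le_one_of_le₀ (Finset.single_le_sum (fun j _ => hv j) (Finset.mem_univ i))
      (Finset.sum_nonneg fun j _ => hv j)
  have hf1 : ∀ z a, ‖f z a‖ ≤ 1 := by
    rintro z (i | i)
    · have h0 : 0 ≤ f z (Sum.inl i) := hε.le.trans ((hT z).2 i)
      rw [Real.norm_of_nonneg h0]
      exact hle1 (fun i => ∑ k, A z i k * Y z k) i fun j => Finset.sum_nonneg fun k _ =>
        mul_nonneg (hm.le.trans (hA z j k).1) (hY z k).le
    · have h0 : 0 ≤ f z (Sum.inr i) := hε.le.trans ((hS z).2 i)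
      rw [Real.norm_of_nonneg h0]
      exact hle1 (fun k => ∑ i, A z i k * U z i) i fun j => Finset.sum_nonneg fun k _ =>
        mul_nonneg (hm.le.trans (hA z k j).1) (hU z k).le
  have hfR : ∀ z, ‖f z‖ ≤ √(Fintype.card (ι ⊕ ι)) := by
    intro z
    rw [EuclideanSpace.norm_eq]
    refine Real.sqrt_le_sqrt ?_
    calc _ ≤ ∑ _a : ι ⊕ ι, (1 : ℝ) :=
          Finset.sum_le_sum fun a _ => pow_le_one₀ (norm_nonneg _) (hf1 z a)
      _ = _ := by simp
  obtain ⟨z, hz⟩ := hf.exists_fixedPoint_of_bounded hfR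
  have hzl : ∀ i, (∑ k, A z i k * Y z k) / ∑ j, ∑ k, A z j k * Y z k = z (Sum.inl i) := fun i =>
    congrArg (fun w : EuclideanSpace ℝ (ι ⊕ ι) => w (Sum.inl i)) hz
  have hzr : ∀ k, (∑ i, A z i k * U z i) / ∑ j, ∑ i, A z i j * U z i = z (Sum.inr k) := fun i =>
    congrArg (fun w : EuclideanSpace ℝ (ι ⊕ ι) => w (Sum.inr i)) hz
  have hYz : ∀ i, Y z i = z (Sum.inl i) := fun i =>
    max_eq_right ((hzl i).symm ▸ (hT z).2 i)
  have hUz : ∀ i, U z i = z (Sum.inr i) := fun i =>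
    max_eq_right ((hzr i).symm ▸ (hS z).2 i)
  have hTpos := (hT z).1
  have hSpos := (hS z).1
  have eqY : ∀ i, ∑ k, A z i k * Y z k = (∑ j, ∑ k, A z j k * Y z k) * Y z i := fun i => by
    rw [hYz i, ← hzl i, mul_div_cancel₀ _ hTpos.ne']
  have eqU : ∀ k, ∑ i, A z i k * U z i = (∑ j, ∑ i, A z i j * U z i) * U z k := fun i => by
    rw [hUz i, ← hzr i, mul_div_cancel₀ _ hSpos.ne']
  generalize (∑ j, ∑ k, A z j k * Y z k) = l at *
  generalize (∑ j, ∑ i, A z i j * U z i) = l' at *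
  -- Evaluate the pairing of `U` with `A Y` in two ways and divide by the positive pairing of `U`
  -- with `Y`.
  have hll : l = l' := by
    have hdot : 0 < ∑ i, U z i * Y z i :=
      Finset.sum_pos (fun i _ => mul_pos (hU z i) (hY z i)) Finset.univ_nonempty
    refine mul_right_cancel₀ hdot.ne' ?_
    calc l * ∑ i, U z i * Y z i = ∑ i, U z i * ∑ k, A z i k * Y z k := by
          rw [Finset.mul_sum]
          exact Finset.sum_congr rfl fun i _ => by rw [eqY]; ring
      _ = ∑ k, (∑ i, A z i k * U z i) * Y z k := by
          simp_rw [Finset.mul_sum, Finset.sum_mul]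
          rw [Finset.sum_comm]
          exact Finset.sum_congr rfl fun i _ => Finset.sum_congr rfl fun k _ => by ring
      _ = l' * ∑ i, U z i * Y z i := by
          rw [Finset.mul_sum]
          exact Finset.sum_congr rfl fun i _ => by rw [eqU]; ring
  exact ⟨Y z, U z, l, hY z, hU z, hTpos, eqY, by rw [hll]; exact eqU⟩

/-! ### Bounds for the productivities -/

namespace ArmingtonEconomy

variable {n : ℕ} {σ : ℝ} {φ ψ : Matrix (Fin n) (Fin n) ℝ} {x : Fin n → ℝ}

theorem IsProximityMatrix.pos (hφ : IsProximityMatrix φ) (i j : Fin n) : 0 < φ i j := by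
  rcases eq_or_ne i j with rfl | h
  · rw [hφ.diag]; exact one_pos
  · exact hφ.off_diag_pos i j h

theorem IsProximityMatrix.le_one (hφ : IsProximityMatrix φ) (i j : Fin n) : φ i j ≤ 1 := by
  rcases eq_or_ne i j with rfl | h
  · rw [hφ.diag]
  · exact (hφ.off_diag_lt_one i j h).le

theorem le_productivity {p : ℝ} (hp : ∀ i j, p ≤ ψ i j) (hx : x ∈ stdSimplex ℝ (Fin n))
    (i : Fin n) : p ≤ productivity ψ x i := by
  calc p = ∑ j, p * x j := by rw [← Finset.mul_sum, hx.2, mul_one]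
    _ ≤ _ := Finset.sum_le_sum fun j _ => mul_le_mul_of_nonneg_right (hp i j) (hx.1 j)

theorem productivity_le_one (hψ : IsExternalityMatrix ψ) (hx : x ∈ stdSimplex ℝ (Fin n))
    (i : Fin n) : productivity ψ x i ≤ 1 := by
  calc productivity ψ x i ≤ ∑ j, x j :=
        Finset.sum_le_sum fun j _ => mul_le_of_le_one_left (hx.1 j) (hψ.le_one i j)
    _ = 1 := hx.2

theorem exists_pos_le_entries [Nonempty (Fin n)] {A : Matrix (Fin n) (Fin n) ℝ}
    (hA : ∀ i j, 0 < A i j) : ∃ p > 0, ∀ i j, p ≤ A i j := by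
  obtain ⟨q, hq⟩ := Finite.exists_min fun q : Fin n × Fin n => A q.1 q.2
  exact ⟨_, hA q.1 q.2, fun i j => hq (i, j)⟩

theorem productivity_pos (hψ : IsExternalityMatrix ψ) (hx : x ∈ stdSimplex ℝ (Fin n))
    (i : Fin n) : 0 < productivity ψ x i := by
  have : Nonempty (Fin n) := ⟨i⟩
  obtain ⟨p, hp, h⟩ := exists_pos_le_entries hψ.pos
  exact hp.trans_le (le_productivity h hx i)

/-! ### Every region is populated in a spatial equilibrium -/

theorem competitiveness_pos (hφ : IsProximityMatrix φ) (hψ : IsExternalityMatrix ψ) (hσ : 1 < σ)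
    (hx : x ∈ stdSimplex ℝ (Fin n)) {w : Fin n → ℝ≥0∞} {i : Fin n} (hw : w i ≠ ∞) (j : Fin n) :
    0 < competitiveness σ φ ψ x w i j := by
  have h1 : 0 < ENNReal.ofReal (productivity ψ x i) ^ (σ - 1) :=
    ENNReal.rpow_pos (ENNReal.ofReal_pos.2 (productivity_pos hψ hx i)) ENNReal.ofReal_ne_top
  have h2 : w i ^ (1 - σ) ≠ 0 := by
    rw [Ne, ENNReal.rpow_eq_zero_iff]
    rintro (⟨-, h⟩ | ⟨h, -⟩)
    · linarith
    · exact hw h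
  exact ENNReal.mul_pos (mul_ne_zero h1.ne' h2) (ENNReal.ofReal_pos.2 (hφ.pos i j)).ne'

theorem competitiveness_ne_top (hσ : 1 < σ) {w : Fin n → ℝ≥0∞} {i : Fin n} (hw : w i ≠ 0)
    (j : Fin n) : competitiveness σ φ ψ x w i j ≠ ∞ := by
  refine ENNReal.mul_ne_top (ENNReal.mul_ne_top ?_ ?_) ENNReal.ofReal_ne_top
  · exact ENNReal.rpow_ne_top_of_nonneg (by linarith) ENNReal.ofReal_ne_top
  · rw [Ne, ENNReal.rpow_eq_top_iff]
    rintro (⟨h, -⟩ | ⟨-, h⟩)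
    · exact hw h
    · linarith

/-- A zero wage makes the denominators of all trade shares infinite; as `c / ∞ = 0` even for `c =
∞`, all incomes vanish, against the normalization. -/
theorem IsMarketWage.ne_zero (hφ : IsProximityMatrix φ) (hψ : IsExternalityMatrix ψ) (hσ : 1 < σ)
    (hx : x ∈ stdSimplex ℝ (Fin n)) {w : Fin n → ℝ≥0∞} (h : IsMarketWage σ φ ψ x w) (i : Fin n) :
    w i ≠ 0 := by
  intro hi
  have htop : ∀ k, competitiveness σ φ ψ x w i k = ∞ := fun k => by
    have h1 : 0 < ENNReal.ofReal (productivity ψ x i) ^ (σ - 1) :=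
      ENNReal.rpow_pos (ENNReal.ofReal_pos.2 (productivity_pos hψ hx i)) ENNReal.ofReal_ne_top
    rw [competitiveness, hi, ENNReal.zero_rpow_of_neg (by linarith), ENNReal.mul_top h1.ne',
      ENNReal.top_mul (ENNReal.ofReal_pos.2 (hφ.pos i k)).ne']
  have hsum : ∀ k, ∑ l, competitiveness σ φ ψ x w l k = ∞ := fun k =>
    ENNReal.sum_eq_top.2 ⟨i, Finset.mem_univ i, htop k⟩
  have hzero : ∀ j, income x w j = 0 := fun j => by
    rw [h.clearing]
    exact Finset.sum_eq_zero fun k _ => by rw [tradeValue, hsum, ENNReal.div_top, zero_mul]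
  have := h.normalized
  simp [hzero] at this

/-- At a finite wage the region would sell a positive value to any region with nonzero income, yet
its own income is zero. -/
theorem IsMarketWage.eq_top_of_eq_zero (hφ : IsProximityMatrix φ) (hψ : IsExternalityMatrix ψ)
    (hσ : 1 < σ) (hx : x ∈ stdSimplex ℝ (Fin n)) {w : Fin n → ℝ≥0∞}
    (h : IsMarketWage σ φ ψ x w) {i : Fin n} (hi : x i = 0) : w i = ∞ := by
  by_contra hw
  obtain ⟨k, hk⟩ : ∃ k, income x w k ≠ 0 := by
    by_contra! hc
    simpa [hc] using h.normalized
  have hzero : ∑ k, tradeValue σ φ ψ x w i k = 0 := by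
    rw [← h.clearing, income, hi, ENNReal.ofReal_zero, mul_zero]
  have hk0 := (Finset.sum_eq_zero_iff.1 hzero) k (Finset.mem_univ k)
  rw [tradeValue, mul_eq_zero, ENNReal.div_eq_zero_iff] at hk0
  rcases hk0 with (h0 | h0) | h0
  · exact (competitiveness_pos hφ hψ hσ hx hw k).ne' h0
  · exact ENNReal.sum_ne_top.2
      (fun l _ => competitiveness_ne_top hσ (h.ne_zero hφ hψ hσ hx l) k) h0
  · exact hk h0

theorem IsSpatialEquilibrium.pos (hφ : IsProximityMatrix φ) (hψ : IsExternalityMatrix ψ)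
    (hσ : 1 < σ) {w : Fin n → ℝ≥0∞} (h : IsSpatialEquilibrium σ φ ψ x w) (i : Fin n) :
    0 < x i := by
  refine (h.mem_simplex.1 i).lt_of_ne' fun hi => ?_
  have hx := h.mem_simplex
  obtain ⟨v, hv, hv'⟩ := h.nash
  obtain ⟨j, hj⟩ : ∃ j, 0 < x j := by
    by_contra! hc
    have : ∑ j, x j ≤ 0 := Finset.sum_nonpos fun j _ => hc j
    linarith [hx.2]
  have hwj : w j ≠ ∞ := by
    intro hw
    have hle : income x w j ≤ 1 := h.market.normalized ▸
      Finset.single_le_sum (fun _ _ => zero_le) (Finset.mem_univ j)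
    rw [income, hw, ENNReal.top_mul (ENNReal.ofReal_pos.2 hj).ne'] at hle
    simp at hle
  have hne : 1 / (1 - σ) < 0 := div_neg_of_pos_of_neg one_pos (by linarith)
  have hS0 : ∀ k, ∑ l, competitiveness σ φ ψ x w l k ≠ 0 := fun k hk =>
    (competitiveness_pos hφ hψ hσ hx hwj k).ne'
      ((Finset.sum_eq_zero_iff.1 hk) j (Finset.mem_univ j))
  have hS1 : ∀ k, ∑ l, competitiveness σ φ ψ x w l k ≠ ∞ := fun k => ENNReal.sum_ne_top.2
    fun l _ => competitiveness_ne_top hσ (h.market.ne_zero hφ hψ hσ hx l) k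
  have hP0 : ∀ k, priceIndex σ φ ψ x w k ≠ 0 := fun k =>
    (ENNReal.rpow_pos (pos_iff_ne_zero.2 (hS0 k)) (hS1 k)).ne'
  have hP1 : ∀ k, priceIndex σ φ ψ x w k ≠ ∞ := fun k =>
    ENNReal.rpow_ne_top_of_ne_zero (hS0 k) (hS1 k)
  have hvi : utility σ φ ψ x w i = ∞ := by
    rw [utility, h.market.eq_top_of_eq_zero hφ hψ hσ hx hi, ENNReal.top_div_of_ne_top (hP1 i)]
  have hvj : utility σ φ ψ x w j ≠ ∞ := ENNReal.div_ne_top hwj (hP0 j)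
  have := hv' i hi
  rw [hvi, ← hv j hj, top_le_iff] at this
  exact hvj this

/-! ### Existence -/

/-- The equilibrium conditions in terms of real numbers, when every region is populated. -/
theorem isSpatialEquilibrium_of_real (hφ : IsProximityMatrix φ) (hψ : IsExternalityMatrix ψ)
    (hx : x ∈ stdSimplex ℝ (Fin n)) (hxpos : ∀ i, 0 < x i) {ω S : Fin n → ℝ} {v : ℝ}
    (hω : ∀ i, 0 < ω i)
    (hS : ∀ k, ∑ i, productivity ψ x i ^ (σ - 1) * ω i ^ (1 - σ) * φ i k = S k)
    (hclear : ∀ i, ω i * x i =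
      ∑ k, productivity ψ x i ^ (σ - 1) * ω i ^ (1 - σ) * φ i k / S k * (ω k * x k))
    (hnorm : ∑ i, ω i * x i = 1) (hv : ∀ i, ω i / S i ^ (1 / (1 - σ)) = v) :
    IsSpatialEquilibrium σ φ ψ x (fun i => ENNReal.ofReal (ω i)) ∧
      ∀ i, utility σ φ ψ x (fun i => ENNReal.ofReal (ω i)) i = ENNReal.ofReal v := by
  have ha := productivity_pos hψ hx
  have hcpos : ∀ i k, 0 < productivity ψ x i ^ (σ - 1) * ω i ^ (1 - σ) * φ i k := fun i k =>
    mul_pos (mul_pos (Real.rpow_pos_of_pos (ha i) _) (Real.rpow_pos_of_pos (hω i) _)) (hφ.pos i k)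
  have hSpos : ∀ k, 0 < S k := fun k =>
    hS k ▸ Finset.sum_pos (fun i _ => hcpos i k) ⟨k, Finset.mem_univ k⟩
  have hcomp : ∀ i k, competitiveness σ φ ψ x (fun i => ENNReal.ofReal (ω i)) i k =
      ENNReal.ofReal (productivity ψ x i ^ (σ - 1) * ω i ^ (1 - σ) * φ i k) := fun i k => by
    rw [competitiveness, ENNReal.ofReal_rpow_of_pos (ha i), ENNReal.ofReal_rpow_of_pos (hω i),
      ← ENNReal.ofReal_mul (Real.rpow_nonneg (ha i).le _), ← ENNReal.ofReal_mul
      (mul_nonneg (Real.rpow_nonneg (ha i).le _) (Real.rpow_nonneg (hω i).le _))]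
  have hsum : ∀ k, ∑ l, competitiveness σ φ ψ x (fun i => ENNReal.ofReal (ω i)) l k =
      ENNReal.ofReal (S k) := fun k => by
    simp_rw [hcomp]
    rw [← ENNReal.ofReal_sum_of_nonneg fun i _ => (hcpos i k).le, hS]
  have hinc : ∀ i, income x (fun i => ENNReal.ofReal (ω i)) i = ENNReal.ofReal (ω i * x i) :=
    fun i => (ENNReal.ofReal_mul (hω i).le).symm
  have hutil : ∀ i, utility σ φ ψ x (fun i => ENNReal.ofReal (ω i)) i = ENNReal.ofReal v :=
    fun i => by
      rw [utility, priceIndex, hsum, ENNReal.ofReal_rpow_of_pos (hSpos i),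
        ← ENNReal.ofReal_div_of_pos (Real.rpow_pos_of_pos (hSpos i) _), hv]
  refine ⟨⟨hx, ⟨fun i => ?_, ?_⟩, ENNReal.ofReal v, fun i _ => hutil i, fun i _ => (hutil i).le⟩,
    hutil⟩
  · simp_rw [tradeValue, hsum, hinc, hcomp]
    rw [hclear i, ENNReal.ofReal_sum_of_nonneg fun k _ => mul_nonneg
      (div_nonneg (hcpos i k).le (hSpos k).le) (mul_pos (hω k) (hxpos k)).le]
    refine Finset.sum_congr rfl fun k _ => ?_
    rw [ENNReal.ofReal_mul (div_nonneg (hcpos i k).le (hSpos k).le),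
      ENNReal.ofReal_div_of_pos (hSpos k)]
  · simp_rw [hinc]
    rw [← ENNReal.ofReal_sum_of_nonneg fun i _ => (mul_pos (hω i) (hxpos i)).le, hnorm,
      ENNReal.ofReal_one]

/-- Equalizing utilities amounts to a pair of eigenvector equations, for the incomes and the wages,
whose common matrix depends on the solution through the productivities. -/
theorem exists_balanced_distribution [Nonempty (Fin n)] (hσ : 1 < σ) (hφ : IsProximityMatrix φ)
    (hψ : IsExternalityMatrix ψ) (β : ℝ) :
    ∃ (x y u : Fin n → ℝ) (Z l : ℝ), x ∈ stdSimplex ℝ (Fin n) ∧ (∀ i, 0 < y i) ∧ (∀ i, 0 < u i) ∧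
      0 < Z ∧ 0 < l ∧ (∀ i, x i = y i * u i ^ β / Z) ∧
      (∀ i, ∑ k, productivity ψ x i ^ (σ - 1) * φ i k * y k = l * y i) ∧
      (∀ k, ∑ i, productivity ψ x i ^ (σ - 1) * φ i k * u i = l * u k) := by
  let Z : (Fin n → ℝ) → (Fin n → ℝ) → ℝ := fun y u => ∑ j, y j * u j ^ β
  let X : (Fin n → ℝ) → (Fin n → ℝ) → Fin n → ℝ := fun y u i => y i * u i ^ β / Z y u
  have hpos : ∀ {y u : Fin n → ℝ}, (∀ i, 0 < y i) → (∀ i, 0 < u i) → ∀ i, 0 < y i * u i ^ β :=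
    fun hy hu i => mul_pos (hy i) (Real.rpow_pos_of_pos (hu i) _)
  have hZ : ∀ {y u : Fin n → ℝ}, (∀ i, 0 < y i) → (∀ i, 0 < u i) → 0 < Z y u := fun hy hu =>
    Finset.sum_pos (fun i _ => hpos hy hu i) Finset.univ_nonempty
  have hX : ∀ {y u : Fin n → ℝ}, (∀ i, 0 < y i) → (∀ i, 0 < u i) →
      X y u ∈ stdSimplex ℝ (Fin n) := fun hy hu =>
    ⟨fun i => (div_pos (hpos hy hu i) (hZ hy hu)).le, by
      simp only [X]
      rw [← Finset.sum_div]
      exact div_self (hZ hy hu).ne'⟩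
  obtain ⟨p, hp, hpψ⟩ := exists_pos_le_entries hψ.pos
  obtain ⟨q, hq, hqφ⟩ := exists_pos_le_entries hφ.pos
  have hs : 0 ≤ σ - 1 := by linarith
  -- Each productivity is a weighted mean of a row of `ψ`, hence lies in `[p, 1]`; this gives the
  -- lower bound `p ^ (σ - 1) * q`.
  have key := exists_pos_left_right_eigenvector
    (fun y u i k => productivity ψ (X y u) i ^ (σ - 1) * φ i k) (m := p ^ (σ - 1) * q)
    (by positivity) ?_ ?_
  · obtain ⟨y, u, l, hy, hu, hl, h1, h2⟩ := key
    exact ⟨X y u, y, u, Z y u, l, hX hy hu, hy, hu, hZ hy hu, hl, fun _ => rfl, h1, h2⟩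
  · intro y u hy hu i k
    have hXs := hX hy hu
    have ha := productivity_pos hψ hXs i
    constructor
    · exact mul_le_mul (Real.rpow_le_rpow hp.le (le_productivity hpψ hXs i) hs) (hqφ i k) hq.le
        (Real.rpow_nonneg ha.le _)
    · exact mul_le_one₀ (Real.rpow_le_one ha.le (productivity_le_one hψ hXs i) hs) (hφ.pos i k).le
        (hφ.le_one i k)
  · intro i k
    have hnum : ∀ j, ContinuousOn (fun p : (Fin n → ℝ) × (Fin n → ℝ) => p.1 j * p.2 j ^ β)
        {p | (∀ i, 0 < p.1 i) ∧ ∀ i, 0 < p.2 i} := fun j =>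
      ContinuousOn.mul (by fun_prop) (ContinuousOn.rpow_const (by fun_prop)
        fun p hp => Or.inl (hp.2 j).ne')
    have hXc : ∀ j, ContinuousOn (fun p : (Fin n → ℝ) × (Fin n → ℝ) => X p.1 p.2 j)
        {p | (∀ i, 0 < p.1 i) ∧ ∀ i, 0 < p.2 i} := fun j =>
      (hnum j).div (continuousOn_finsetSum _ fun j _ => hnum j) fun p hp => (hZ hp.1 hp.2).ne'
    refine ContinuousOn.mul (ContinuousOn.rpow_const ?_ fun _ _ => Or.inr hs) continuousOn_const
    exact continuousOn_finsetSum _ fun j _ => continuousOn_const.mul (hXc j)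

/-- Wages are recovered from `u` by inverting `u = w ^ (1 - σ)` up to scale; the exponent `σ / (σ -
1)` then makes income proportional to `u * y`. -/
theorem exists_isSpatialEquilibrium [Nonempty (Fin n)] (hσ : 1 < σ) (hφ : IsProximityMatrix φ)
    (hψ : IsExternalityMatrix ψ) :
    ∃ (x : Fin n → ℝ) (w : Fin n → ℝ≥0∞) (v : ℝ≥0∞), IsSpatialEquilibrium σ φ ψ x w ∧
      ∀ i, utility σ φ ψ x w i = v := by
  obtain ⟨x, y, u, Z, l, hx, hy, hu, hZ, hl, hxy, h1, h2⟩ :=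
    exists_balanced_distribution hσ hφ hψ (σ / (σ - 1))
  have hs : 0 < σ - 1 := by linarith
  have hs' : 1 - σ ≠ 0 := by linarith
  have hxpos : ∀ i, 0 < x i := fun i => by
    have := hy i
    have := hu i
    rw [hxy]
    positivity
  -- Scale of the wages for which total income is one.
  let c : ℝ := Z / ∑ i, u i * y i
  have hdot : 0 < ∑ i, u i * y i :=
    Finset.sum_pos (fun i _ => mul_pos (hu i) (hy i)) Finset.univ_nonempty
  have hc : 0 < c := div_pos hZ hdot
  let ω : Fin n → ℝ := fun i => c * u i ^ (1 / (1 - σ))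
  have hω : ∀ i, 0 < ω i := fun i => mul_pos hc (Real.rpow_pos_of_pos (hu i) _)
  have hωpow : ∀ i, ω i ^ (1 - σ) = c ^ (1 - σ) * u i := fun i => by
    simp only [ω]
    rw [Real.mul_rpow hc.le (Real.rpow_nonneg (hu i).le _), ← Real.rpow_mul (hu i).le,
      one_div_mul_cancel hs', Real.rpow_one]
  have hωx : ∀ i, ω i * x i = c / Z * (u i * y i) := fun i => by
    have : u i ^ (1 / (1 - σ)) * u i ^ (σ / (σ - 1)) = u i := by
      rw [← Real.rpow_add (hu i)]
      have : 1 / (1 - σ) + σ / (σ - 1) = 1 := by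
        rw [← neg_sub σ 1]
        field_simp
        ring
      rw [this, Real.rpow_one]
    rw [hxy]
    calc ω i * (y i * u i ^ (σ / (σ - 1)) / Z) =
        c / Z * ((u i ^ (1 / (1 - σ)) * u i ^ (σ / (σ - 1))) * y i) := by simp only [ω]; ring
      _ = _ := by rw [this]
  have hcp : 0 < c ^ (1 - σ) := Real.rpow_pos_of_pos hc _
  -- `S k` is `P_k ^ (1 - σ)`, so `P_k = l ^ (1 / (1 - σ)) * ω k` and the utility is the same in
  -- every region.
  have key := isSpatialEquilibrium_of_real (σ := σ) hφ hψ hx hxpos (ω := ω)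
    (S := fun k => c ^ (1 - σ) * l * u k) (v := (l ^ (1 / (1 - σ)))⁻¹) hω ?_ ?_ ?_ ?_
  · exact ⟨x, _, _, key⟩
  · intro k
    calc _ = c ^ (1 - σ) * ∑ i, productivity ψ x i ^ (σ - 1) * φ i k * u i := by
          rw [Finset.mul_sum]
          exact Finset.sum_congr rfl fun i _ => by rw [hωpow]; ring
      _ = _ := by rw [h2]; ring
  · intro i
    calc ω i * x i = c / Z * u i / l * ∑ k, productivity ψ x i ^ (σ - 1) * φ i k * y k := by
          rw [hωx, h1]
          field_simp
      _ = _ := by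
          rw [Finset.mul_sum]
          refine Finset.sum_congr rfl fun k _ => ?_
          have := hu k
          rw [hωpow, hωx]
          field_simp
  · simp_rw [hωx]
    rw [← Finset.mul_sum]
    simp only [c]
    field_simp
  · intro i
    have h3 : (c ^ (1 - σ)) ^ (1 / (1 - σ)) = c := by
      rw [← Real.rpow_mul hc.le, mul_one_div_cancel hs', Real.rpow_one]
    have h4 : 0 < l ^ (1 / (1 - σ)) := Real.rpow_pos_of_pos hl _
    have h5 : 0 < u i ^ (1 / (1 - σ)) := Real.rpow_pos_of_pos (hu i) _
    simp only [ω]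
    rw [Real.mul_rpow (by positivity) (hu i).le, Real.mul_rpow hcp.le hl.le, h3]
    generalize l ^ (1 / (1 - σ)) = L at *
    generalize u i ^ (1 / (1 - σ)) = V at *
    field_simp

end ArmingtonEconomy

theorem mainTheorem5 {n : ℕ} (hn : 1 ≤ n) (σ : ℝ) (hσ : 1 < σ)
    (φ ψ : Matrix (Fin n) (Fin n) ℝ)
    (hφ : ArmingtonEconomy.IsProximityMatrix φ) (hψ : ArmingtonEconomy.IsExternalityMatrix ψ) :
    (∃ (x : Fin n → ℝ) (w : Fin n → ENNReal),
      ArmingtonEconomy.IsSpatialEquilibrium σ φ ψ x w ∧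
      ∀ i j, ArmingtonEconomy.utility σ φ ψ x w i = ArmingtonEconomy.utility σ φ ψ x w j) ∧
    (∀ (x : Fin n → ℝ) (w : Fin n → ENNReal),
      ArmingtonEconomy.IsSpatialEquilibrium σ φ ψ x w → ∀ i, 0 < x i) := by
  have : Nonempty (Fin n) := ⟨⟨0, hn⟩⟩
  obtain ⟨x, w, v, h, hv⟩ := ArmingtonEconomy.exists_isSpatialEquilibrium hσ hφ hψ
  exact ⟨⟨x, w, h, fun i j => (hv i).trans (hv j).symm⟩, fun x w h => h.pos hφ hψ hσ⟩
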